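/- Let $w\ge 0$ be an integer. There are constants $r$ and $K$, depending only on $w$, with the following property. Let $L\ge 0$, let qubits be placed at the sites of the $L\times L$ square lattice $\{0,\dots,L-1\}^2$, with either open or periodic boundary conditions, and let $\mathcal S$ be a finite set of mutually commuting orthogonal projectors on the Hilbert space $(\mathbb C^2)^{\otimes L^2}$ of these qubits, each of which acts as the identity outside some $w\times w$ square of sites. (With open boundary conditions, intervals of coordinates $\{a,\dots,a+\ell-1\}$ are intersected with $\{0,\dots,L-1\}$; with periodic ones they are taken modulo $L$.) Let the code space be the simultaneous eigenspace with eigenvalue one of all the projectors in $\mathcal S$, and suppose that its dimension is greater than one. Then there are an integer $i \ge 0$ and a Hermitian operator $\mathcal H$ such that 1. $\mathcal H$ is a nontrivial logical operator: it maps the code space into itself, and its restriction to the code space is not proportional to the identity; 2. $\mathcal H$ is supported on the vertical strip $M'=\{i,\dots,i+r-1\}\times\{0,\dots,L-1\}$ (that is, it acts as the identity on the other qubits); 3. for any division of $M'$ across its length into two rectangles $A=\{i,\dots,i+r-1\}\times I$ and $B=\{i,\dots,i+r-1\}\times J$, where $I$ and $J$ are complementary intervals of rows (possibly empty; cyclic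 intervals for periodic boundary conditions), the Schmidt rank of $\mathcal H$ across the $A$–$B$ cut is at most $K$. Here the Schmidt rank is the number of terms in a Schmidt decomposition $\mathcal H=\sum_\alpha\sqrt{\lambda_\alpha}\,\mathcal O_A^\alpha\otimes\mathcal O_B^\alpha$ with all $\lambda_\alpha>0$, where the $\mathcal O_A^\alpha$ and $\mathcal O_B^\alpha$ are operators on the qubits in $A$ and in $B$ with $\operatorname{tr}(\mathcal O_A^{\alpha\dagger}\mathcal O_A^\beta)=2^{|A|}\delta^{\alpha\beta}$ and $\operatorname{tr}(\mathcal O_B^{\alpha\dagger}\mathcal O_B^\beta)=2^{|B|}\delta^{\alpha\beta}$. -/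

import Mathlib

/-- Basis configurations of qubits placed at the points of `Λ`.  The Hilbert space of the qubits is
`Config Λ → ℂ`. -/
abbrev Config (Λ : Type) : Type := Λ → Fin 2

/-- Operators on the qubits at the points of `Λ`, as matrices in the computational basis. -/
abbrev QubitOp (Λ : Type) : Type := Matrix (Config Λ) (Config Λ) ℂ

/-- The operator `X ⊗ 1` on all the qubits, where `X` acts on the qubits in `A` and the identity
acts on the qubits outside `A`. -/
def extendOp {Λ : Type} [Fintype Λ] [DecidableEq Λ] (A : Finset Λ) (X : QubitOp A) : QubitOp Λ :=
  Matrix.of fun s t =>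
    if ∀ i, i ∉ A → s i = t i then X (fun i => s i) (fun i => t i) else 0

/-- The operator `O` is supported on the set of qubits `A`. -/
def SupportedOn {Λ : Type} [Fintype Λ] [DecidableEq Λ] (A : Finset Λ) (O : QubitOp Λ) : Prop :=
  ∃ X : QubitOp A, O = extendOp A X

/-- `O = ∑ α, √(lam α) • OA α ⊗ OB α` is a Schmidt decomposition of `O` across the `A`-`B` cut, with
`m` terms, all of them nonzero. -/
structure IsSchmidtDecomposition {Λ : Type} [Fintype Λ] [DecidableEq Λ] (A B : Finset Λ)
    (O : QubitOp Λ) {m : ℕ} (lam : Fin m → ℝ) (OA : Fin m → QubitOp A) (OB : Fin m → QubitOp B) :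
    Prop where
  pos : ∀ α, 0 < lam α
  orthoA : ∀ α β, ((OA α).conjTranspose * OA β).trace = if α = β then (2 : ℂ) ^ A.card else 0
  orthoB : ∀ α β, ((OB α).conjTranspose * OB β).trace = if α = β then (2 : ℂ) ^ B.card else 0
  eq_sum : O = ∑ α, ((Real.sqrt (lam α) : ℝ) : ℂ) • (extendOp A (OA α) * extendOp B (OB α))

/-- The operator `O`, supported on the union of the disjoint sets `A` and `B`, has Schmidt rank `m`
across the `A`-`B` cut: it has a Schmidt decomposition with exactly `m` nonzero terms. -/
def HasSchmidtRank {Λ : Type} [Fintype Λ] [DecidableEq Λ] (A B : Finset Λ) (O : QubitOp Λ)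
    (m : ℕ) : Prop :=
  Disjoint A B ∧ ∃ (lam : Fin m → ℝ) (OA : Fin m → QubitOp A) (OB : Fin m → QubitOp B),
    IsSchmidtDecomposition A B O lam OA OB

/-- The boundary conditions of the lattice: open (`free`) or `periodic`. -/
inductive Boundary : Type
  | free
  | periodic

/-- The sites of the `L × L` square lattice, as (column, row). -/
abbrev Site (L : ℕ) : Type := Fin L × Fin L

/-- The coordinates `a, a + 1, …, a + l - 1`: those that lie in `{0, …, L - 1}` for open boundary
conditions, and all of them, taken modulo `L`, for periodic ones. -/
def interval (L : ℕ) : Boundary → ℕ → ℕ → Finset (Fin L)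
  | Boundary.free, a, l => Finset.univ.filter fun x => a ≤ (x : ℕ) ∧ (x : ℕ) < a + l
  | Boundary.periodic, a, l => Finset.univ.filter fun x => ∃ j, j < l ∧ (x : ℕ) = (a + j) % L

/-- The `w × w` square of sites with corner `(a, b)`. -/
def square (L : ℕ) (bc : Boundary) (w a b : ℕ) : Finset (Site L) :=
  interval L bc a w ×ˢ interval L bc b w

/-- The vertical strip that consists of the columns `i, …, i + r - 1`. -/
def strip (L : ℕ) (bc : Boundary) (r i : ℕ) : Finset (Site L) :=
  interval L bc i r ×ˢ Finset.univ

/-- `A` and `B` are rectangles into which the strip is divided by cutting across it: each of them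
has the full width of the strip, and they consist of complementary intervals of rows. -/
def IsStripDivision (L : ℕ) (bc : Boundary) (r i : ℕ) (A B : Finset (Site L)) : Prop :=
  ∃ a h a' h' : ℕ, interval L bc a' h' = (interval L bc a h)ᶜ ∧
    A = interval L bc i r ×ˢ interval L bc a h ∧ B = interval L bc i r ×ˢ interval L bc a' h'

/-- A set of mutually commuting (orthogonal) projectors on the qubits of the `L × L` square lattice,
each of which acts trivially outside some `w × w` square. -/
structure LocalCommutingProjectorCode (L : ℕ) (bc : Boundary) (w : ℕ) : Type where
  projectors : Finset (QubitOp (Site L))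
  isProj : ∀ P ∈ projectors, IsStarProjection P
  commute : ∀ P ∈ projectors, ∀ Q ∈ projectors, Commute P Q
  isLocal : ∀ P ∈ projectors, ∃ a b : ℕ, SupportedOn (square L bc w a b) P

namespace LocalCommutingProjectorCode

variable {L : ℕ} {bc : Boundary} {w : ℕ}

/-- The simultaneous eigenspace with eigenvalue one of the projectors. -/
def codeSpace (C : LocalCommutingProjectorCode L bc w) : Submodule ℂ (Config (Site L) → ℂ) where
  carrier := {ψ | ∀ P ∈ C.projectors, P.mulVec ψ = ψ}
  zero_mem' := fun P _ => Matrix.mulVec_zero P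
  add_mem' := fun hx hy P hP => by rw [Matrix.mulVec_add, hx P hP, hy P hP]
  smul_mem' := fun c ψ hψ P hP => by rw [Matrix.mulVec_smul, hψ P hP]

/-- The code is nontrivial: its code space has dimension greater than one. -/
def IsNontrivial (C : LocalCommutingProjectorCode L bc w) : Prop :=
  1 < Module.finrank ℂ C.codeSpace

/-- `O` is a logical operator: it preserves the code space. -/
def IsLogical (C : LocalCommutingProjectorCode L bc w) (O : QubitOp (Site L)) : Prop :=
  ∀ ψ ∈ C.codeSpace, O.mulVec ψ ∈ C.codeSpace

/-- `O` is a nontrivial logical operator: it preserves the code space, and its restriction to the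
code space is not proportional to the identity. -/
def IsNontrivialLogical (C : LocalCommutingProjectorCode L bc w) (O : QubitOp (Site L)) : Prop :=
  C.IsLogical O ∧ ¬ ∃ c : ℂ, ∀ ψ ∈ C.codeSpace, O.mulVec ψ = c • ψ

end LocalCommutingProjectorCode

/-! ### Operators supported on subsets of the qubits. -/

section Operators

variable {Λ : Type} [Fintype Λ] [DecidableEq Λ]

/-! Let Π be the product of all the projectors, i.e. the projection onto the code space. Call a
region M correctable if Π E Π is a multiple of Π for every matrix unit E on M.

Group the columns into strips of bounded width so that no projector meets two strips of the same
parity. If every strip were correctable, so would be the union of the even strips and that of the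
odd ones (`Correctable.union`). These unions are complementary, so by no-cloning
(`eq_zero_of_correctable_compl`) the code space could not contain two orthogonal nonzero states.
Hence some strip M is not correctable, witnessed by a matrix unit E.

A Hermitian combination G of E and its adjoint is a witness too, and it has tensor rank at most 2
across any cut, since matrix units are product operators. Let Q be the product of the projectors
that touch M. Then Q G Q commutes with every projector, and Π Q G Q Π = Π G Π, so it is a nontrivial
logical operator (`dress_commute`, `isNontrivialLogical_dress`) on a slightly wider strip.

Across a cut, the projectors in Q lie on one side or near the ends of the row intervals. The latter
act on boundedly many qubits, so Q has bounded tensor rank (`prodOf_tensorRankLE`). The singular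
value decomposition turns tensor rank into Schmidt rank. -/

theorem extendOp_apply (A : Finset Λ) (X : QubitOp A) (s t : Config Λ) :
    extendOp A X s t =
      if ∀ i, i ∉ A → s i = t i then X (fun i => s i) (fun i => t i) else 0 := rfl

/-- Gluing of configurations on complementary sets of qubits. -/
def splitConfig (A B : Finset Λ) (h : ∀ i, i ∈ B ↔ i ∉ A) : Config Λ ≃ Config A × Config B where
  toFun s := (fun i => s i, fun i => s i)
  invFun pq i := if hi : i ∈ A then pq.1 ⟨i, hi⟩ else pq.2 ⟨i, (h i).2 hi⟩
  left_inv s := by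
    funext i
    by_cases hi : i ∈ A <;> simp [hi]
  right_inv pq := by
    refine Prod.ext ?_ ?_
    · funext i
      simp [i.2]
    · funext i
      have : (i : Λ) ∉ A := (h i).1 i.2
      simp [this]

theorem extendOp_apply_split (A B : Finset Λ) (h : ∀ i, i ∈ B ↔ i ∉ A) (X : QubitOp A)
    (s t : Config Λ) :
    extendOp A X s t = if (splitConfig A B h s).2 = (splitConfig A B h t).2 then
      X (splitConfig A B h s).1 (splitConfig A B h t).1 else 0 := by
  rw [extendOp_apply]
  refine if_congr ?_ rfl rfl
  simp only [splitConfig, Equiv.coe_fn_mk, funext_iff, Subtype.forall, h]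

theorem extendOp_mul (A : Finset Λ) (X Y : QubitOp A) :
    extendOp A (X * Y) = extendOp A X * extendOp A Y := by
  have h : ∀ i, i ∈ Aᶜ ↔ i ∉ A := fun i => Finset.mem_compl
  ext s t
  rw [Matrix.mul_apply, ← (splitConfig A Aᶜ h).symm.sum_comp, Fintype.sum_prod_type]
  simp only [extendOp_apply_split A Aᶜ h, Equiv.apply_symm_apply, ite_mul, zero_mul, mul_ite,
    mul_zero]
  simp [Matrix.mul_apply]

theorem extendOp_one (A : Finset Λ) : extendOp A (1 : QubitOp A) = 1 := by
  ext s t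
  rw [extendOp_apply, Matrix.one_apply, Matrix.one_apply, ← ite_and]
  refine if_congr ⟨fun h => ?_, fun h => by simp [h]⟩ rfl rfl
  funext i
  by_cases hi : i ∈ A
  · exact congrFun h.2 ⟨i, hi⟩
  · exact h.1 i hi

theorem extendOp_sum {ι : Type*} (A : Finset Λ) (T : Finset ι) (X : ι → QubitOp A) :
    extendOp A (∑ k ∈ T, X k) = ∑ k ∈ T, extendOp A (X k) := by
  ext s t
  simp only [Matrix.sum_apply, extendOp_apply]
  split_ifs <;> simp

theorem extendOp_smul (A : Finset Λ) (c : ℂ) (X : QubitOp A) :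
    extendOp A (c • X) = c • extendOp A X := by
  ext s t
  simp only [Matrix.smul_apply, extendOp_apply]
  split_ifs <;> simp

theorem extendOp_add (A : Finset Λ) (X Y : QubitOp A) :
    extendOp A (X + Y) = extendOp A X + extendOp A Y := by
  ext s t
  simp only [Matrix.add_apply, extendOp_apply]
  split_ifs <;> simp

theorem extendOp_conjTranspose (A : Finset Λ) (X : QubitOp A) :
    (extendOp A X).conjTranspose = extendOp A X.conjTranspose := by
  ext s t
  simp only [Matrix.conjTranspose_apply, extendOp_apply, eq_comm (a := t _)]
  split_ifs <;> simp

theorem extendOp_mul_extendOp_apply {A B : Finset Λ} (hAB : Disjoint A B) (X : QubitOp A)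
    (Y : QubitOp B) (s t : Config Λ) :
    (extendOp A X * extendOp B Y) s t =
      if ∀ i, i ∉ A → i ∉ B → s i = t i then
        X (fun i => s i) (fun i => t i) * Y (fun i => s i) (fun i => t i) else 0 := by
  have hB : ∀ i ∈ B, i ∉ A := fun i hi hi' => (Finset.disjoint_left.1 hAB) hi' hi
  -- The only intermediate configuration that can contribute is `t` on `A` and `s` elsewhere.
  rw [Matrix.mul_apply, Finset.sum_eq_single (A.piecewise t s)]
  · have h1 : (fun i : A => A.piecewise t s i) = fun i : A => t i := by
      funext i; simp
    have h2 : (fun i : B => A.piecewise t s i) = fun i : B => s i := by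
      funext i; simp [hB i i.2]
    rw [extendOp_apply, extendOp_apply, h1, h2, if_pos]
    · split_ifs with h3 h4 h4
      · rfl
      · exact absurd (fun i hA hB => by simpa [hA] using h3 i hB) h4
      · refine absurd (fun i hi => ?_) h3
        by_cases hA : i ∈ A
        · simp [hA]
        · simpa [hA] using h4 i hA hi
      · simp
    · intro i hi
      simp [hi]
  · intro u _ hu
    by_contra hne
    refine hu ?_
    have h1 : ∀ i, i ∉ A → s i = u i := by
      by_contra h
      exact hne (by rw [extendOp_apply, if_neg h, zero_mul])
    have h2 : ∀ i, i ∉ B → u i = t i := by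
      by_contra h
      exact hne (by rw [extendOp_apply B, if_neg h, mul_zero])
    funext i
    by_cases hi : i ∈ A
    · simpa [hi] using h2 i (Finset.disjoint_left.1 hAB hi)
    · simpa [hi] using (h1 i hi).symm
  · simp

theorem extendOp_commute {A B : Finset Λ} (hAB : Disjoint A B) (X : QubitOp A) (Y : QubitOp B) :
    Commute (extendOp A X) (extendOp B Y) := by
  ext s t
  rw [extendOp_mul_extendOp_apply hAB, extendOp_mul_extendOp_apply hAB.symm, mul_comm]
  exact if_congr ⟨fun h i a b => h i b a, fun h i a b => h i b a⟩ rfl rfl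

theorem SupportedOn.mono {A B : Finset Λ} (hAB : A ⊆ B) {O : QubitOp Λ} (h : SupportedOn A O) :
    SupportedOn B O := by
  obtain ⟨X, rfl⟩ := h
  refine ⟨Matrix.of fun p q => if ∀ i : B, (i : Λ) ∉ A → p i = q i then
    X (fun i => p ⟨i, hAB i.2⟩) (fun i => q ⟨i, hAB i.2⟩) else 0, ?_⟩
  ext s t
  simp only [extendOp_apply, Matrix.of_apply, ← ite_and]
  refine if_congr ⟨fun h => ⟨fun i hi => h i fun hA => hi (hAB hA), fun i hi => h i hi⟩, ?_⟩ rfl rfl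
  rintro ⟨h1, h2⟩ i hi
  by_cases hB : i ∈ B
  · exact h2 ⟨i, hB⟩ hi
  · exact h1 i hB

theorem SupportedOn.mul {A : Finset Λ} {O O' : QubitOp Λ} (h : SupportedOn A O)
    (h' : SupportedOn A O') : SupportedOn A (O * O') := by
  obtain ⟨X, rfl⟩ := h
  obtain ⟨Y, rfl⟩ := h'
  exact ⟨X * Y, (extendOp_mul A X Y).symm⟩

theorem SupportedOn.one (A : Finset Λ) : SupportedOn A (1 : QubitOp Λ) :=
  ⟨1, (extendOp_one A).symm⟩

theorem SupportedOn.add {A : Finset Λ} {O O' : QubitOp Λ} (h : SupportedOn A O)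
    (h' : SupportedOn A O') : SupportedOn A (O + O') := by
  obtain ⟨X, rfl⟩ := h
  obtain ⟨Y, rfl⟩ := h'
  exact ⟨X + Y, (extendOp_add A X Y).symm⟩

theorem SupportedOn.smul {A : Finset Λ} {O : QubitOp Λ} (c : ℂ) (h : SupportedOn A O) :
    SupportedOn A (c • O) := by
  obtain ⟨X, rfl⟩ := h
  exact ⟨c • X, (extendOp_smul A c X).symm⟩

theorem SupportedOn.conjTranspose {A : Finset Λ} {O : QubitOp Λ} (h : SupportedOn A O) :
    SupportedOn A O.conjTranspose := by
  obtain ⟨X, rfl⟩ := h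
  exact ⟨_, extendOp_conjTranspose A X⟩

theorem SupportedOn.commute {A B : Finset Λ} (hAB : Disjoint A B) {O O' : QubitOp Λ}
    (h : SupportedOn A O) (h' : SupportedOn B O') : Commute O O' := by
  obtain ⟨X, rfl⟩ := h
  obtain ⟨Y, rfl⟩ := h'
  exact extendOp_commute hAB X Y

theorem SupportedOn.list_prod {A : Finset Λ} {l : List (QubitOp Λ)}
    (h : ∀ P ∈ l, SupportedOn A P) : SupportedOn A l.prod := by
  induction l with
  | nil => exact SupportedOn.one A
  | cons P l ih =>
    rw [List.prod_cons]
    exact (h P (by simp)).mul (ih fun Q hQ => h Q (by simp [hQ]))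

/-- The operator `|s⟩⟨t|` on the qubits in `A`, tensored with the identity. -/
def matrixUnit (A : Finset Λ) (s t : Config Λ) : QubitOp Λ :=
  extendOp A (Matrix.single (fun i => s i) (fun i => t i) 1)

theorem matrixUnit_supportedOn (A : Finset Λ) (s t : Config Λ) :
    SupportedOn A (matrixUnit A s t) := ⟨_, rfl⟩

theorem matrixUnit_conjTranspose (A : Finset Λ) (s t : Config Λ) :
    (matrixUnit A s t).conjTranspose = matrixUnit A t s := by
  rw [matrixUnit, extendOp_conjTranspose, Matrix.conjTranspose_single, star_one, matrixUnit]

/-- Matrix units are product operators; this is why correctability is tested on them and why the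
witness has small tensor rank. -/
theorem matrixUnit_union {A B : Finset Λ} (hAB : Disjoint A B) (s t : Config Λ) :
    matrixUnit (A ∪ B) s t = matrixUnit A s t * matrixUnit B s t := by
  ext u v
  rw [matrixUnit, matrixUnit, matrixUnit, extendOp_mul_extendOp_apply hAB, extendOp_apply]
  simp only [Matrix.single_apply, mul_ite, mul_one, mul_zero, ← ite_and]
  refine if_congr ?_ rfl rfl
  simp only [funext_iff, Subtype.forall, Finset.mem_union, not_or, and_imp, or_imp,
    forall_and]
  tauto

theorem matrixUnit_empty (s t : Config Λ) : matrixUnit ∅ s t = 1 := by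
  rw [matrixUnit, ← extendOp_one ∅]
  congr 1

/-- Extension of a configuration by zero. -/
def zeroExtend (A : Finset Λ) (p : Config A) : Config Λ :=
  fun i => if h : i ∈ A then p ⟨i, h⟩ else 0

omit [Fintype Λ] in
theorem zeroExtend_restrict (A : Finset Λ) (p : Config A) :
    (fun i : A => zeroExtend A p i) = p := by
  funext i
  simp [zeroExtend]

theorem extendOp_eq_sum_matrixUnit (A : Finset Λ) (X : QubitOp A) :
    extendOp A X = ∑ pq : Config A × Config A,
      X pq.1 pq.2 • matrixUnit A (zeroExtend A pq.1) (zeroExtend A pq.2) := by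
  conv_lhs => rw [Matrix.matrix_eq_sum_single X]
  rw [Fintype.sum_prod_type, extendOp_sum]
  refine Finset.sum_congr rfl fun p _ => ?_
  rw [extendOp_sum]
  refine Finset.sum_congr rfl fun q _ => ?_
  rw [matrixUnit, zeroExtend_restrict, zeroExtend_restrict, ← extendOp_smul, Matrix.smul_single,
    smul_eq_mul, mul_one]

end Operators

/-! ### Products of commuting idempotents. -/

section Projections

variable {R : Type*} [Monoid R]

theorem List.mul_prod_eq_prod_of_mem {l : List R} (hl : ∀ a ∈ l, ∀ b ∈ l, Commute a b)
    (hi : ∀ a ∈ l, a * a = a) {a : R} (ha : a ∈ l) : a * l.prod = l.prod := by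
  induction l with
  | nil => simp at ha
  | cons b l ih =>
    rw [List.prod_cons, ← mul_assoc]
    rcases List.mem_cons.1 ha with rfl | ha'
    · rw [hi a (by simp)]
    · rw [hl a ha b (by simp), mul_assoc, ih (fun x hx y hy => hl x (by simp [hx]) y (by simp [hy]))
        (fun x hx => hi x (by simp [hx])) ha']

theorem List.prod_mul_eq_of_absorb {l : List R} {e : R} (h : ∀ a ∈ l, a * e = e) :
    l.prod * e = e := by
  induction l with
  | nil => simp
  | cons b l ih =>
    rw [List.prod_cons, mul_assoc, ih fun a ha => h a (by simp [ha]), h b (by simp)]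

/-- The product of commuting idempotents depends only on which idempotents occur in it. -/
theorem List.prod_eq_prod_of_mem_iff {l l' : List R} (hl : ∀ a ∈ l, ∀ b ∈ l, Commute a b)
    (hi : ∀ a ∈ l, a * a = a) (h : ∀ a, a ∈ l ↔ a ∈ l') : l.prod = l'.prod := by
  have hl' : ∀ a ∈ l', ∀ b ∈ l', Commute a b := fun a ha b hb =>
    hl a ((h a).2 ha) b ((h b).2 hb)
  have hi' : ∀ a ∈ l', a * a = a := fun a ha => hi a ((h a).2 ha)
  have h1 : l.prod * l'.prod = l'.prod := prod_mul_eq_of_absorb fun a ha =>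
    mul_prod_eq_prod_of_mem hl' hi' ((h a).1 ha)
  have h2 : l'.prod * l.prod = l.prod := prod_mul_eq_of_absorb fun a ha =>
    mul_prod_eq_prod_of_mem hl hi ((h a).2 ha)
  have h3 : Commute l.prod l'.prod := Commute.list_prod_right _ _ fun b hb =>
    Commute.list_prod_left _ _ fun a ha => hl a ha b ((h b).2 hb)
  rw [← h2, ← h3, h1]

theorem List.star_prod_of_commute [StarMul R] {l : List R} (hl : ∀ a ∈ l, ∀ b ∈ l, Commute a b)
    (hs : ∀ a ∈ l, star a = a) : star l.prod = l.prod := by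
  induction l with
  | nil => simp
  | cons b l ih =>
    rw [List.prod_cons, star_mul, hs b (by simp),
      ih (fun x hx y hy => hl x (by simp [hx]) y (by simp [hy])) (fun x hx => hs x (by simp [hx]))]
    exact (Commute.list_prod_right l b fun a ha => hl b (by simp) a (by simp [ha])).symm

end Projections

/-! ### Singular values, tensor rank and Schmidt rank. -/

section SchmidtRank

open scoped ComplexOrder in
/-- Singular value decomposition of a complex matrix, with nonzero singular values only. -/
theorem Matrix.exists_singular_value_decomposition {m n : Type*} [Fintype m] [DecidableEq m]
    [Fintype n] (R : Matrix m n ℂ) :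
    ∃ (σ : Fin R.rank → ℝ) (u : Fin R.rank → m → ℂ) (v : Fin R.rank → n → ℂ),
      (∀ α, 0 < σ α) ∧
      (∀ α β, ∑ i, star (u α i) * u β i = if α = β then 1 else 0) ∧
      (∀ α β, ∑ j, star (v α j) * v β j = if α = β then 1 else 0) ∧
      ∀ i j, R i j = ∑ α, (σ α : ℂ) * (u α i * v α j) := by
  have hA : (R * R.conjTranspose).IsHermitian := Matrix.isHermitian_mul_conjTranspose_self R
  have hpos : ∀ i, 0 ≤ hA.eigenvalues i :=
    (Matrix.posSemidef_self_mul_conjTranspose R).eigenvalues_nonneg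
  have hcard : Fintype.card {i // hA.eigenvalues i ≠ 0} = R.rank := by
    rw [← hA.rank_eq_card_non_zero_eigs, Matrix.rank_self_mul_conjTranspose]
  let e : Fin R.rank ≃ {i // hA.eigenvalues i ≠ 0} := (Fintype.equivFinOfCardEq hcard).symm
  let U : Matrix m m ℂ := (hA.eigenvectorUnitary : Matrix m m ℂ)
  have hU1 : U.conjTranspose * U = 1 := Matrix.mem_unitaryGroup_iff'.1 hA.eigenvectorUnitary.2
  have hU2 : U * U.conjTranspose = 1 := Matrix.mem_unitaryGroup_iff.1 hA.eigenvectorUnitary.2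
  -- The rows of `S` are orthogonal, with the eigenvalues as squared norms. The left singular
  -- vectors are the columns of `U`, the right ones the normalised nonzero rows of `S`.
  let S : Matrix m n ℂ := U.conjTranspose * R
  have hRS : R = U * S := by rw [← Matrix.mul_assoc, hU2, Matrix.one_mul]
  have hSS : S * S.conjTranspose = Matrix.diagonal fun i => (hA.eigenvalues i : ℂ) := by
    have h := hA.conjStarAlgAut_star_eigenvectorUnitary
    rw [Unitary.conjStarAlgAut_apply] at h
    rw [Matrix.conjTranspose_mul, Matrix.conjTranspose_conjTranspose, Matrix.mul_assoc,
      ← Matrix.mul_assoc R, ← Matrix.mul_assoc]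
    rw [Unitary.coe_star, star_star, Matrix.star_eq_conjTranspose] at h
    exact h
  have hrow : ∀ i k, ∑ j, S i j * star (S k j) = if i = k then (hA.eigenvalues i : ℂ) else 0 := by
    intro i k
    have := congrFun (congrFun hSS i) k
    rwa [Matrix.mul_apply, Matrix.diagonal_apply] at this
  have hzero : ∀ i, hA.eigenvalues i = 0 → ∀ j, S i j = 0 := by
    intro i hi j
    have h := hrow i i
    rw [if_pos rfl, hi, Complex.ofReal_zero] at h
    exact congrFun (dotProduct_self_star_eq_zero.1 h) j
  have hσ : ∀ α, 0 < Real.sqrt (hA.eigenvalues (e α)) := fun α =>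
    Real.sqrt_pos.2 (lt_of_le_of_ne (hpos _) (e α).2.symm)
  refine ⟨fun α => Real.sqrt (hA.eigenvalues (e α)), fun α i => U i (e α),
    fun α j => ((Real.sqrt (hA.eigenvalues (e α)) : ℝ) : ℂ)⁻¹ * S (e α) j, hσ, ?_, ?_, ?_⟩
  · intro α β
    have := congrFun (congrFun hU1 (e α)) (e β)
    rw [Matrix.mul_apply, Matrix.one_apply] at this
    simpa [Subtype.ext_iff.symm] using this
  · intro α β
    have h := hrow (e β) (e α)
    have h1 : ∀ j, star (((Real.sqrt (hA.eigenvalues (e α)) : ℝ) : ℂ)⁻¹ * S (e α) j) *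
        (((Real.sqrt (hA.eigenvalues (e β)) : ℝ) : ℂ)⁻¹ * S (e β) j) =
        ((Real.sqrt (hA.eigenvalues (e α)) : ℝ) : ℂ)⁻¹ *
          ((Real.sqrt (hA.eigenvalues (e β)) : ℝ) : ℂ)⁻¹ * (S (e β) j * star (S (e α) j)) := by
      intro j
      rw [star_mul', star_inv₀]
      simp only [Complex.star_def, Complex.conj_ofReal]
      ring
    simp only [h1]
    rw [← Finset.mul_sum, h]
    by_cases hab : α = β
    · subst hab
      have hne : ((Real.sqrt (hA.eigenvalues (e α)) : ℝ) : ℂ) ≠ 0 :=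
        Complex.ofReal_ne_zero.2 (hσ α).ne'
      rw [if_pos rfl, if_pos rfl]
      nth_rewrite 3 [← Real.mul_self_sqrt (hpos (e α))]
      push_cast
      field_simp
    · rw [if_neg hab, if_neg, mul_zero]
      exact fun h => hab (e.injective (Subtype.ext h.symm))
  · intro i j
    have h1 : ∀ α, ((Real.sqrt (hA.eigenvalues (e α)) : ℝ) : ℂ) * (U i (e α) *
        (((Real.sqrt (hA.eigenvalues (e α)) : ℝ) : ℂ)⁻¹ * S (e α) j)) = U i (e α) * S (e α) j := by
      intro α
      have hne : ((Real.sqrt (hA.eigenvalues (e α)) : ℝ) : ℂ) ≠ 0 :=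
        Complex.ofReal_ne_zero.2 (hσ α).ne'
      field_simp
    simp only [h1]
    rw [e.sum_comp fun k : {i // hA.eigenvalues i ≠ 0} => U i k * S k j,
      ← Finset.sum_subtype (Finset.univ.filter fun k => hA.eigenvalues k ≠ 0) (by simp)
        fun k => U i k * S k j,
      Finset.sum_filter_of_ne]
    · exact congrFun (congrFun hRS i) j
    · exact fun k _ hk hk' => hk (by rw [hzero k hk' j, mul_zero])

variable {Λ : Type} [Fintype Λ] [DecidableEq Λ]

/-- `O` is a sum of at most `n` products of an operator on `A` and an operator on `B`. -/
def TensorRankLE (A B : Finset Λ) (O : QubitOp Λ) (n : ℕ) : Prop :=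
  ∃ (ι : Type) (_ : Fintype ι) (X : ι → QubitOp A) (Y : ι → QubitOp B),
    Fintype.card ι ≤ n ∧ O = ∑ k, extendOp A (X k) * extendOp B (Y k)

theorem TensorRankLE.of_supportedOn {ι : Type} [Fintype ι] {A B : Finset Λ} {O : QubitOp Λ}
    {a b : ι → QubitOp Λ} (ha : ∀ k, SupportedOn A (a k)) (hb : ∀ k, SupportedOn B (b k))
    (h : O = ∑ k, a k * b k) : TensorRankLE A B O (Fintype.card ι) := by
  choose X hX using ha
  choose Y hY using hb
  exact ⟨ι, inferInstance, X, Y, le_rfl, by simp only [h, hX, hY]⟩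

theorem TensorRankLE.of_mul {A B : Finset Λ} {a b : QubitOp Λ} (ha : SupportedOn A a)
    (hb : SupportedOn B b) : TensorRankLE A B (a * b) 1 :=
  TensorRankLE.of_supportedOn (ι := Unit) (fun _ => ha) (fun _ => hb) (by simp)

theorem TensorRankLE.mono {A B : Finset Λ} {O : QubitOp Λ} {n n' : ℕ}
    (h : TensorRankLE A B O n) (hn : n ≤ n') : TensorRankLE A B O n' := by
  obtain ⟨ι, _, X, Y, hc, rfl⟩ := h
  exact ⟨ι, inferInstance, X, Y, hc.trans hn, rfl⟩

theorem TensorRankLE.add {A B : Finset Λ} {O O' : QubitOp Λ} {n n' : ℕ}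
    (h : TensorRankLE A B O n) (h' : TensorRankLE A B O' n') :
    TensorRankLE A B (O + O') (n + n') := by
  obtain ⟨ι, _, X, Y, hc, rfl⟩ := h
  obtain ⟨ι', _, X', Y', hc', rfl⟩ := h'
  refine ⟨ι ⊕ ι', inferInstance, Sum.elim X X', Sum.elim Y Y', ?_, by simp⟩
  rw [Fintype.card_sum]
  exact Nat.add_le_add hc hc'

theorem TensorRankLE.smul {A B : Finset Λ} {O : QubitOp Λ} {n : ℕ} (c : ℂ)
    (h : TensorRankLE A B O n) : TensorRankLE A B (c • O) n := by
  obtain ⟨ι, _, X, Y, hc, rfl⟩ := h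
  refine ⟨ι, inferInstance, fun k => c • X k, Y, hc, ?_⟩
  simp only [Finset.smul_sum, extendOp_smul, smul_mul_assoc]

/-- Factors on `A` commute past factors on `B`, so the products of terms are again of product form.
-/
theorem TensorRankLE.mul {A B : Finset Λ} (hAB : Disjoint A B) {O O' : QubitOp Λ} {n n' : ℕ}
    (h : TensorRankLE A B O n) (h' : TensorRankLE A B O' n') :
    TensorRankLE A B (O * O') (n * n') := by
  obtain ⟨ι, _, X, Y, hc, rfl⟩ := h
  obtain ⟨ι', _, X', Y', hc', rfl⟩ := h'
  refine ⟨ι × ι', inferInstance, fun k => X k.1 * X' k.2, fun k => Y k.1 * Y' k.2, ?_, ?_⟩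
  · rw [Fintype.card_prod]
    exact Nat.mul_le_mul hc hc'
  · rw [Finset.sum_mul_sum, Fintype.sum_prod_type]
    refine Finset.sum_congr rfl fun k _ => Finset.sum_congr rfl fun k' _ => ?_
    rw [extendOp_mul, extendOp_mul]
    exact Commute.mul_mul_mul_comm (extendOp_commute hAB (X' k') (Y k)).symm _ _

theorem matrixUnit_tensorRankLE {A B D : Finset Λ} (hAB : Disjoint A B) (hD : D ⊆ A ∪ B)
    (s t : Config Λ) : TensorRankLE A B (matrixUnit D s t) 1 := by
  have hD' : D = (D ∩ A) ∪ (D ∩ B) := by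
    rw [← Finset.inter_union_distrib_left, Finset.inter_eq_left.2 hD]
  rw [hD', matrixUnit_union
    (hAB.mono Finset.inter_subset_right Finset.inter_subset_right)]
  exact TensorRankLE.of_mul ((matrixUnit_supportedOn _ s t).mono Finset.inter_subset_right)
    ((matrixUnit_supportedOn _ s t).mono Finset.inter_subset_right)

/-- There are `4 ^ D.card` matrix units on `D`, each of them a product across the cut. -/
theorem SupportedOn.tensorRankLE {A B D : Finset Λ} (hAB : Disjoint A B) (hD : D ⊆ A ∪ B)
    {O : QubitOp Λ} (hO : SupportedOn D O) : TensorRankLE A B O (4 ^ D.card) := by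
  obtain ⟨X, rfl⟩ := hO
  have h : ∀ pq : Config D × Config D, ∃ a b : QubitOp Λ, SupportedOn A a ∧ SupportedOn B b ∧
      X pq.1 pq.2 • matrixUnit D (zeroExtend D pq.1) (zeroExtend D pq.2) = a * b := by
    intro pq
    have hD' : D = (D ∩ A) ∪ (D ∩ B) := by
      rw [← Finset.inter_union_distrib_left, Finset.inter_eq_left.2 hD]
    refine ⟨X pq.1 pq.2 • matrixUnit (D ∩ A) (zeroExtend D pq.1) (zeroExtend D pq.2),
      matrixUnit (D ∩ B) (zeroExtend D pq.1) (zeroExtend D pq.2),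
      ((matrixUnit_supportedOn _ _ _).smul _).mono Finset.inter_subset_right,
      (matrixUnit_supportedOn _ _ _).mono Finset.inter_subset_right, ?_⟩
    rw [smul_mul_assoc, ← matrixUnit_union
      (hAB.mono Finset.inter_subset_right Finset.inter_subset_right), ← hD']
  choose a b ha hb hab using h
  have hcard : Fintype.card (Config D × Config D) = 4 ^ D.card := by
    rw [Fintype.card_prod, Fintype.card_fun, Fintype.card_fin, Fintype.card_coe, ← mul_pow]
    norm_num
  rw [← hcard]
  exact TensorRankLE.of_supportedOn ha hb
    ((extendOp_eq_sum_matrixUnit D X).trans (Finset.sum_congr rfl fun k _ => hab k))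

/-- Viewed as a matrix from `B`-indices to `A`-indices, a sum of `n` products factors through an
index set of size at most `n`, which bounds its rank. Its singular value decomposition is the
Schmidt decomposition up to normalisation. -/
theorem TensorRankLE.hasSchmidtRank {A B : Finset Λ} (hAB : Disjoint A B) {O : QubitOp Λ} {n : ℕ}
    (h : TensorRankLE A B O n) : ∃ m, m ≤ n ∧ HasSchmidtRank A B O m := by
  obtain ⟨ι, _, X, Y, hc, rfl⟩ := h
  let V : Matrix (Config A × Config A) ι ℂ := Matrix.of fun p k => X k p.1 p.2
  let W : Matrix ι (Config B × Config B) ℂ := Matrix.of fun k q => Y k q.1 q.2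
  obtain ⟨σ, u, v, hσ, hu, hv, hR⟩ := (V * W).exists_singular_value_decomposition
  have hrank : (V * W).rank ≤ n :=
    ((Matrix.rank_mul_le_left V W).trans (Matrix.rank_le_card_width V)).trans hc
  let a : ℝ := Real.sqrt (2 ^ A.card)
  let b : ℝ := Real.sqrt (2 ^ B.card)
  have ha : 0 < a := Real.sqrt_pos.2 (by positivity)
  have hb : 0 < b := Real.sqrt_pos.2 (by positivity)
  have haa : (a : ℂ) * a = 2 ^ A.card := by
    rw [← Complex.ofReal_mul, Real.mul_self_sqrt (by positivity)]
    push_cast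
    rfl
  have hbb : (b : ℂ) * b = 2 ^ B.card := by
    rw [← Complex.ofReal_mul, Real.mul_self_sqrt (by positivity)]
    push_cast
    rfl
  -- Unit vectors are rescaled by `a` and `b` to have squared norms `2 ^ A.card` and `2 ^ B.card`;
  -- the coefficients compensate.
  refine ⟨(V * W).rank, hrank, hAB, fun α => (σ α / (a * b)) ^ 2,
    fun α => Matrix.of fun p p' => (a : ℂ) * u α (p, p'),
    fun α => Matrix.of fun q q' => (b : ℂ) * v α (q, q'), ?_⟩
  constructor
  · intro α
    have := hσ α
    positivity
  · intro α β
    have h := hu α β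
    rw [Fintype.sum_prod_type_right] at h
    simp only [Matrix.trace, Matrix.diag_apply, Matrix.mul_apply, Matrix.conjTranspose_apply,
      Matrix.of_apply, star_mul', Complex.star_def, Complex.conj_ofReal] at h ⊢
    simp only [mul_mul_mul_comm, ← Finset.mul_sum, h, haa]
    split_ifs <;> simp
  · intro α β
    have h := hv α β
    rw [Fintype.sum_prod_type_right] at h
    simp only [Matrix.trace, Matrix.diag_apply, Matrix.mul_apply, Matrix.conjTranspose_apply,
      Matrix.of_apply, star_mul', Complex.star_def, Complex.conj_ofReal] at h ⊢
    simp only [mul_mul_mul_comm, ← Finset.mul_sum, h, hbb]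
    split_ifs <;> simp
  · ext s t
    simp only [Matrix.sum_apply, Matrix.smul_apply, extendOp_mul_extendOp_apply hAB]
    split_ifs with hst
    · have h := hR ((fun i => s i), fun i => t i) ((fun i => s i), fun i => t i)
      rw [Matrix.mul_apply] at h
      refine h.trans (Finset.sum_congr rfl fun α _ => ?_)
      rw [Real.sqrt_sq (by have := hσ α; positivity)]
      have ha' : (a : ℂ) ≠ 0 := Complex.ofReal_ne_zero.2 ha.ne'
      have hb' : (b : ℂ) ≠ 0 := Complex.ofReal_ne_zero.2 hb.ne'
      simp only [Matrix.of_apply, smul_eq_mul]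
      push_cast
      field_simp
    · simp

end SchmidtRank

/-! ### Commuting projections, dressed operators and correctable regions. -/

/-- A finite set of commuting projections together with regions on which they are supported. -/
structure CommutingProjections (Λ : Type) [Fintype Λ] [DecidableEq Λ] where
  carrier : Finset (QubitOp Λ)
  isProj : ∀ P ∈ carrier, IsStarProjection P
  commute : ∀ P ∈ carrier, ∀ Q ∈ carrier, Commute P Q
  region : QubitOp Λ → Finset Λ
  supportedOn : ∀ P ∈ carrier, SupportedOn (region P) P

namespace CommutingProjections

variable {Λ : Type} [Fintype Λ] [DecidableEq Λ] (F : CommutingProjections Λ)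

/-- The product of the projections that satisfy `p`. -/
noncomputable def prodOf (p : QubitOp Λ → Prop) [DecidablePred p] : QubitOp Λ :=
  (F.carrier.filter p).toList.prod

/-- The projection onto the code space. -/
noncomputable def codeProj : QubitOp Λ := F.carrier.toList.prod

/-- The projections that may act nontrivially on `M`. -/
def Touches (M : Finset Λ) (P : QubitOp Λ) : Prop := ¬ Disjoint (F.region P) M

instance (M : Finset Λ) : DecidablePred (F.Touches M) := fun _ => inferInstanceAs (Decidable (¬ _))

variable {F}

theorem mul_prodOf {p : QubitOp Λ → Prop} [DecidablePred p] {P : QubitOp Λ} (hP : P ∈ F.carrier)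
    (hp : p P) : P * F.prodOf p = F.prodOf p := by
  refine List.mul_prod_eq_prod_of_mem (fun a ha b hb => ?_) (fun a ha => ?_) (by simp [hP, hp])
  · simp only [Finset.mem_toList, Finset.mem_filter] at ha hb
    exact F.commute a ha.1 b hb.1
  · simp only [Finset.mem_toList, Finset.mem_filter] at ha
    exact (F.isProj a ha.1).isIdempotentElem

theorem commute_prodOf {p : QubitOp Λ → Prop} [DecidablePred p] {O : QubitOp Λ}
    (h : ∀ P ∈ F.carrier, p P → Commute O P) : Commute O (F.prodOf p) := by
  refine Commute.list_prod_right _ _ fun a ha => ?_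
  simp only [Finset.mem_toList, Finset.mem_filter] at ha
  exact h a ha.1 ha.2

theorem prodOf_mul {p : QubitOp Λ → Prop} [DecidablePred p] {P : QubitOp Λ} (hP : P ∈ F.carrier)
    (hp : p P) : F.prodOf p * P = F.prodOf p := by
  rw [← (commute_prodOf fun Q hQ _ => F.commute P hP Q hQ).eq, mul_prodOf hP hp]

theorem prodOf_supportedOn {p : QubitOp Λ → Prop} [DecidablePred p] {A : Finset Λ}
    (h : ∀ P ∈ F.carrier, p P → SupportedOn A P) : SupportedOn A (F.prodOf p) := by
  refine SupportedOn.list_prod fun a ha => ?_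
  simp only [Finset.mem_toList, Finset.mem_filter] at ha
  exact h a ha.1 ha.2

theorem prodOf_conjTranspose (p : QubitOp Λ → Prop) [DecidablePred p] :
    (F.prodOf p).conjTranspose = F.prodOf p := by
  refine List.star_prod_of_commute (fun a ha b hb => ?_) (fun a ha => ?_)
  · simp only [Finset.mem_toList, Finset.mem_filter] at ha hb
    exact F.commute a ha.1 b hb.1
  · simp only [Finset.mem_toList, Finset.mem_filter] at ha
    exact (F.isProj a ha.1).isSelfAdjoint

/-- The classes `q` and `r` may overlap: repeated commuting idempotents do not change the product.
-/
theorem prodOf_eq_mul (p q r : QubitOp Λ → Prop) [DecidablePred p] [DecidablePred q]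
    [DecidablePred r] (h : ∀ P ∈ F.carrier, p P ↔ q P ∨ r P) :
    F.prodOf p = F.prodOf q * F.prodOf r := by
  rw [prodOf, prodOf, prodOf, ← List.prod_append]
  refine List.prod_eq_prod_of_mem_iff (fun a ha b hb => ?_) (fun a ha => ?_) fun a => ?_
  · simp only [Finset.mem_toList, Finset.mem_filter] at ha hb
    exact F.commute a ha.1 b hb.1
  · simp only [Finset.mem_toList, Finset.mem_filter] at ha
    exact (F.isProj a ha.1).isIdempotentElem
  · simp only [List.mem_append, Finset.mem_toList, Finset.mem_filter]
    have := h a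
    tauto

theorem codeProj_eq_prodOf : F.codeProj = F.prodOf fun _ => True := by
  rw [codeProj, prodOf, Finset.filter_true]

theorem mul_codeProj {P : QubitOp Λ} (hP : P ∈ F.carrier) : P * F.codeProj = F.codeProj := by
  rw [codeProj_eq_prodOf, mul_prodOf hP trivial]

theorem commute_codeProj {O : QubitOp Λ} (h : ∀ P ∈ F.carrier, Commute O P) :
    Commute O F.codeProj :=
  Commute.list_prod_right _ _ fun a ha => h a (Finset.mem_toList.1 ha)

theorem codeProj_conjTranspose : F.codeProj.conjTranspose = F.codeProj := by
  rw [codeProj_eq_prodOf, prodOf_conjTranspose]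

theorem prodOf_mul_codeProj (p : QubitOp Λ → Prop) [DecidablePred p] :
    F.prodOf p * F.codeProj = F.codeProj := by
  refine List.prod_mul_eq_of_absorb fun a ha => ?_
  simp only [Finset.mem_toList, Finset.mem_filter] at ha
  exact mul_codeProj ha.1

theorem codeProj_mul_prodOf (p : QubitOp Λ → Prop) [DecidablePred p] :
    F.codeProj * F.prodOf p = F.codeProj := by
  rw [← (commute_codeProj fun P hP => (commute_prodOf fun Q hQ _ => F.commute P hP Q hQ).symm).eq,
    prodOf_mul_codeProj]

theorem codeProj_mul_self : F.codeProj * F.codeProj = F.codeProj := by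
  nth_rewrite 1 [codeProj_eq_prodOf]
  exact prodOf_mul_codeProj _

theorem codeProj_mulVec {ψ : Config Λ → ℂ} (h : ∀ P ∈ F.carrier, P.mulVec ψ = ψ) :
    F.codeProj.mulVec ψ = ψ := by
  have : ∀ l : List (QubitOp Λ), (∀ P ∈ l, P.mulVec ψ = ψ) → l.prod.mulVec ψ = ψ := by
    intro l
    induction l with
    | nil => simp
    | cons P l ih =>
      intro hl
      rw [List.prod_cons, ← Matrix.mulVec_mulVec, ih fun Q hQ => hl Q (by simp [hQ]),
        hl P (by simp)]
  exact this _ fun P hP => h P (Finset.mem_toList.1 hP)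

/-- An operator `G` on `M`, dressed by the projections that touch `M`. -/
noncomputable def dress (F : CommutingProjections Λ) (M : Finset Λ) (G : QubitOp Λ) : QubitOp Λ :=
  F.prodOf (F.Touches M) * G * F.prodOf (F.Touches M)

/-- A projection that touches `M` is absorbed on either side; any other commutes with `G` and with
the dressing. -/
theorem dress_commute {M : Finset Λ} {G : QubitOp Λ} (hG : SupportedOn M G) {P : QubitOp Λ}
    (hP : P ∈ F.carrier) : Commute (F.dress M G) P := by
  by_cases h : F.Touches M P
  · rw [commute_iff_eq, dress, mul_assoc, prodOf_mul hP h, ← mul_assoc, ← mul_assoc,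
      mul_prodOf hP h]
  · have h1 : Commute G P :=
      hG.commute (disjoint_comm.1 (not_not.1 h)) (F.supportedOn P hP)
    have h2 : Commute (F.prodOf (F.Touches M)) P :=
      (commute_prodOf fun Q hQ _ => F.commute P hP Q hQ).symm
    exact (h2.mul_left h1).mul_left h2

theorem codeProj_dress_codeProj (M : Finset Λ) (G : QubitOp Λ) :
    F.codeProj * F.dress M G * F.codeProj = F.codeProj * G * F.codeProj := by
  rw [dress, ← mul_assoc, ← mul_assoc, codeProj_mul_prodOf, mul_assoc _ (F.prodOf _),
    prodOf_mul_codeProj]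

variable (F) in
/-- The operators on `M` do not act nontrivially on the code space. -/
def Correctable (M : Finset Λ) : Prop :=
  ∀ s t, ∃ c : ℂ, F.codeProj * matrixUnit M s t * F.codeProj = c • F.codeProj

/-- With E, E' the matrix units on `M`, `N` and Q the product of the projections touching `M`, E'
commutes with Q. Inserting Q next to Π therefore gives Π E E' Π = Π (Q E Q) E' Π. The dressed
operator commutes with Π, so this equals (Q E Q)(Π E' Π), and both factors reduce to scalars on the
code space. -/
theorem Correctable.union {M N : Finset Λ} (hMN : Disjoint M N) (hM : F.Correctable M)
    (hN : F.Correctable N) (h : ∀ P ∈ F.carrier, F.Touches M P → ¬ F.Touches N P) :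
    F.Correctable (M ∪ N) := by
  intro s t
  obtain ⟨c, hc⟩ := hM s t
  obtain ⟨d, hd⟩ := hN s t
  refine ⟨d * c, ?_⟩
  have hG := matrixUnit_supportedOn M s t
  have h1 : F.dress M (matrixUnit M s t) * F.codeProj = c • F.codeProj := by
    rw [← hc, ← codeProj_dress_codeProj,
      ← (commute_codeProj fun P hP => dress_commute hG hP).eq, mul_assoc, codeProj_mul_self]
  have h2 : Commute (matrixUnit N s t) (F.prodOf (F.Touches M)) :=
    commute_prodOf fun P hP hPM => (matrixUnit_supportedOn N s t).commute
      (disjoint_comm.1 (not_not.1 (h P hP hPM))) (F.supportedOn P hP)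
  have h3 : F.codeProj * F.dress M (matrixUnit M s t) =
      F.codeProj * matrixUnit M s t * F.prodOf (F.Touches M) := by
    rw [dress, ← mul_assoc, ← mul_assoc, codeProj_mul_prodOf]
  calc F.codeProj * matrixUnit (M ∪ N) s t * F.codeProj
      = F.codeProj * matrixUnit M s t * matrixUnit N s t *
          (F.prodOf (F.Touches M) * F.codeProj) := by
        rw [matrixUnit_union hMN, prodOf_mul_codeProj, mul_assoc _ _ (matrixUnit N s t)]
    _ = F.codeProj * F.dress M (matrixUnit M s t) * (matrixUnit N s t * F.codeProj) := by
        rw [h3, ← mul_assoc, mul_assoc _ (matrixUnit N s t), h2.eq]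
        simp only [mul_assoc]
    _ = F.dress M (matrixUnit M s t) * (F.codeProj * matrixUnit N s t * F.codeProj) := by
        rw [← (commute_codeProj fun P hP => dress_commute hG hP).eq]
        simp only [mul_assoc]
    _ = (d * c) • F.codeProj := by
        rw [hd, mul_smul_comm, h1, smul_smul]

theorem correctable_empty : F.Correctable ∅ := fun s t => ⟨1, by
  rw [matrixUnit_empty, mul_one, one_smul, codeProj_mul_self]⟩

theorem correctable_biUnion (M : ℕ → Finset Λ) (I : Finset ℕ)
    (hM : ∀ p ∈ I, F.Correctable (M p))
    (hdisj : ∀ p ∈ I, ∀ q ∈ I, p ≠ q → Disjoint (M p) (M q))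
    (h : ∀ p ∈ I, ∀ q ∈ I, p ≠ q → ∀ P ∈ F.carrier, F.Touches (M p) P → ¬ F.Touches (M q) P) :
    F.Correctable (I.biUnion M) := by
  induction I using Finset.induction_on with
  | empty => exact correctable_empty
  | insert p I hp ih =>
    rw [Finset.biUnion_insert]
    have hne : ∀ q ∈ I, p ≠ q := fun q hq hpq => hp (hpq ▸ hq)
    refine Correctable.union ?_ (hM p (by simp)) (ih (fun q hq => hM q (by simp [hq]))
      (fun q hq r hr => hdisj q (by simp [hq]) r (by simp [hr]))
      (fun q hq r hr => h q (by simp [hq]) r (by simp [hr]))) ?_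
    · rw [Finset.disjoint_biUnion_right]
      exact fun q hq => hdisj p (by simp) q (by simp [hq]) (hne q hq)
    · intro P hP hPp
      refine not_not.2 ?_
      rw [Finset.disjoint_biUnion_right]
      exact fun q hq => not_not.1 (h p (by simp) q (by simp [hq]) (hne q hq) P hP hPp)

/-! ### No-cloning for complementary correctable regions. -/

section NoCloning

/-- The amplitudes of a state as a matrix, for a division of the qubits into `A` and `B`. -/
def amplitudes (A B : Finset Λ) (h : ∀ i, i ∈ B ↔ i ∉ A) (ψ : Config Λ → ℂ) :
    Matrix (Config A) (Config B) ℂ :=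
  Matrix.of fun p q => ψ ((splitConfig A B h).symm (p, q))

theorem extendOp_apply_split_right (A B : Finset Λ) (h : ∀ i, i ∈ B ↔ i ∉ A) (Y : QubitOp B)
    (s t : Config Λ) :
    extendOp B Y s t = if (splitConfig A B h s).1 = (splitConfig A B h t).1 then
      Y (splitConfig A B h s).2 (splitConfig A B h t).2 else 0 := by
  rw [extendOp_apply]
  refine if_congr ?_ rfl rfl
  simp only [splitConfig, Equiv.coe_fn_mk, funext_iff, Subtype.forall, h, not_not]

/-- Expectations of matrix units on `A` are the entries of the partial trace of |φ⟩⟨ψ| over `B`. -/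
theorem dotProduct_matrixUnit_left (A B : Finset Λ) (h : ∀ i, i ∈ B ↔ i ∉ A)
    (ψ φ : Config Λ → ℂ) (p p' : Config A) :
    star ψ ⬝ᵥ (matrixUnit A (zeroExtend A p) (zeroExtend A p')).mulVec φ =
      (amplitudes A B h φ * (amplitudes A B h ψ).conjTranspose) p' p := by
  have hv : ∀ u, (matrixUnit A (zeroExtend A p) (zeroExtend A p')).mulVec φ u =
      if p = (splitConfig A B h u).1 then
        φ ((splitConfig A B h).symm (p', (splitConfig A B h u).2)) else 0 := by
    intro u
    rw [Matrix.mulVec, dotProduct, ← (splitConfig A B h).symm.sum_comp, Fintype.sum_prod_type]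
    simp only [matrixUnit, zeroExtend_restrict, extendOp_apply_split A B h,
      Equiv.apply_symm_apply, Matrix.single_apply]
    by_cases hp : p = (splitConfig A B h u).1 <;> simp [hp]
  simp only [dotProduct, hv]
  rw [← (splitConfig A B h).symm.sum_comp, Fintype.sum_prod_type]
  simp only [Equiv.apply_symm_apply]
  rw [Finset.sum_comm]
  simp [Matrix.mul_apply, amplitudes, mul_comm]

theorem dotProduct_matrixUnit_right (A B : Finset Λ) (h : ∀ i, i ∈ B ↔ i ∉ A)
    (ψ φ : Config Λ → ℂ) (q q' : Config B) :
    star ψ ⬝ᵥ (matrixUnit B (zeroExtend B q) (zeroExtend B q')).mulVec φ =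
      ((amplitudes A B h ψ).conjTranspose * amplitudes A B h φ) q q' := by
  have hv : ∀ u, (matrixUnit B (zeroExtend B q) (zeroExtend B q')).mulVec φ u =
      if q = (splitConfig A B h u).2 then
        φ ((splitConfig A B h).symm ((splitConfig A B h u).1, q')) else 0 := by
    intro u
    rw [Matrix.mulVec, dotProduct, ← (splitConfig A B h).symm.sum_comp, Fintype.sum_prod_type]
    simp only [matrixUnit, zeroExtend_restrict, extendOp_apply_split_right A B h,
      Equiv.apply_symm_apply, Matrix.single_apply]
    rw [Finset.sum_comm]
    by_cases hq : q = (splitConfig A B h u).2 <;> simp [hq]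
  simp only [dotProduct, hv]
  rw [← (splitConfig A B h).symm.sum_comp, Fintype.sum_prod_type]
  simp only [Equiv.apply_symm_apply]
  simp [Matrix.mul_apply, amplitudes]

theorem Correctable.exists_dotProduct_eq {M : Finset Λ} (hM : F.Correctable M) (s t : Config Λ) :
    ∃ c : ℂ, ∀ ψ φ : Config Λ → ℂ, F.codeProj.mulVec ψ = ψ → F.codeProj.mulVec φ = φ →
      star ψ ⬝ᵥ (matrixUnit M s t).mulVec φ = c * (star ψ ⬝ᵥ φ) := by
  obtain ⟨c, hc⟩ := hM s t
  refine ⟨c, fun ψ φ hψ hφ => ?_⟩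
  have h1 : star ψ ⬝ᵥ (F.codeProj * matrixUnit M s t * F.codeProj).mulVec φ =
      star ψ ⬝ᵥ (matrixUnit M s t).mulVec φ := by
    rw [← Matrix.mulVec_mulVec, hφ, ← Matrix.mulVec_mulVec, Matrix.dotProduct_mulVec _ F.codeProj,
      ← codeProj_conjTranspose, ← Matrix.star_mulVec, hψ]
  rw [← h1, hc, Matrix.smul_mulVec, hφ, dotProduct_smul, smul_eq_mul]

open scoped ComplexOrder in
/-- If a region and its complement are both correctable, then the code space does not contain two
orthogonal states. -/
theorem eq_zero_of_correctable_compl {A B : Finset Λ} (h : ∀ i, i ∈ B ↔ i ∉ A)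
    (hA : F.Correctable A) (hB : F.Correctable B) {ψ φ : Config Λ → ℂ}
    (hψ : F.codeProj.mulVec ψ = ψ) (hφ : F.codeProj.mulVec φ = φ) (hψ0 : ψ ≠ 0)
    (horth : star ψ ⬝ᵥ φ = 0) : φ = 0 := by
  set Ψ := amplitudes A B h ψ
  set Φ := amplitudes A B h φ
  -- Operators on `A` cannot connect the orthogonal states.
  have h1 : Φ * Ψ.conjTranspose = 0 := by
    ext p' p
    obtain ⟨c, hc⟩ := hA.exists_dotProduct_eq (zeroExtend A p) (zeroExtend A p')
    rw [← dotProduct_matrixUnit_left, hc ψ φ hψ hφ, horth, mul_zero, Matrix.zero_apply]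
  -- Operators on `B` cannot distinguish the states, so their reduced states on `B` agree after
  -- normalisation. With `h1` this forces ΦΦ†Φ = 0.
  have h2 : (star ψ ⬝ᵥ ψ) • (Φ.conjTranspose * Φ) = (star φ ⬝ᵥ φ) • (Ψ.conjTranspose * Ψ) := by
    ext q q'
    obtain ⟨c, hc⟩ := hB.exists_dotProduct_eq (zeroExtend B q) (zeroExtend B q')
    rw [Matrix.smul_apply, Matrix.smul_apply, ← dotProduct_matrixUnit_right,
      ← dotProduct_matrixUnit_right, hc ψ ψ hψ hψ, hc φ φ hφ hφ, smul_eq_mul, smul_eq_mul]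
    ring
  have h3 : (star ψ ⬝ᵥ ψ) • (Φ * (Φ.conjTranspose * Φ)) = 0 := by
    rw [← Matrix.mul_smul, h2, Matrix.mul_smul, ← Matrix.mul_assoc, h1, Matrix.zero_mul, smul_zero]
  have h4 : Φ * (Φ.conjTranspose * Φ) = 0 :=
    (smul_eq_zero.1 h3).resolve_left fun h0 => hψ0 (dotProduct_star_self_eq_zero.1 h0)
  have h5 : Φ = 0 := by
    rw [← Matrix.mul_assoc, Matrix.self_mul_conjTranspose_mul_eq_zero,
      Matrix.conjTranspose_mul_self_eq_zero] at h4
    exact h4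
  funext s
  have := congrFun (congrFun h5 (splitConfig A B h s).1) (splitConfig A B h s).2
  simpa [Φ, amplitudes] using this

end NoCloning

/-- If no projection touches two blocks of the same parity, then some block is not correctable. -/
theorem exists_block_not_correctable (blk : Λ → ℕ)
    (hblk : ∀ P ∈ F.carrier, ∀ x ∈ F.region P, ∀ y ∈ F.region P, blk x % 2 = blk y % 2 →
      blk x = blk y) {ψ φ : Config Λ → ℂ}
    (hψ : F.codeProj.mulVec ψ = ψ) (hφ : F.codeProj.mulVec φ = φ) (hψ0 : ψ ≠ 0) (hφ0 : φ ≠ 0)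
    (horth : star ψ ⬝ᵥ φ = 0) :
    ∃ p, ¬ F.Correctable (Finset.univ.filter fun x => blk x = p) := by
  by_contra! hcon
  -- The cases `e = 0` and `e = 1` are complementary regions.
  have key : ∀ e, F.Correctable (Finset.univ.filter fun x => blk x % 2 = e) := by
    intro e
    have h1 : (Finset.univ.filter fun x => blk x % 2 = e) =
        ((Finset.univ.image blk).filter fun p => p % 2 = e).biUnion
          fun p => Finset.univ.filter fun x => blk x = p := by
      ext x
      simp
    rw [h1]
    refine correctable_biUnion _ _ (fun p _ => hcon p) (fun p _ q _ hpq => ?_) ?_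
    · refine Finset.disjoint_left.2 fun x hx hx' => hpq ?_
      rw [← (Finset.mem_filter.1 hx).2, ← (Finset.mem_filter.1 hx').2]
    · intro p hp q hq hpq P hP h2 h3
      obtain ⟨x, hx, hx'⟩ := Finset.not_disjoint_iff.1 h2
      obtain ⟨y, hy, hy'⟩ := Finset.not_disjoint_iff.1 h3
      have hxp := (Finset.mem_filter.1 hx').2
      have hyq := (Finset.mem_filter.1 hy').2
      refine hpq ?_
      rw [← hxp, ← hyq]
      refine hblk P hP x hx y hy ?_
      rw [hxp, hyq, (Finset.mem_filter.1 hp).2, (Finset.mem_filter.1 hq).2]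
  exact hφ0 (eq_zero_of_correctable_compl (fun i => by simp) (key 0) (key 1) hψ hφ hψ0 horth)

end CommutingProjections

/-! ### Intervals and blocks of columns. -/

section Geometry

theorem card_interval_le (L : ℕ) (bc : Boundary) (a l : ℕ) : (interval L bc a l).card ≤ l := by
  cases bc with
  | free =>
    calc (interval L Boundary.free a l).card
        ≤ ((Finset.Ico a (a + l)).card) := by
          refine Finset.card_le_card_of_injOn (fun x : Fin L => (x : ℕ)) ?_
            Fin.val_injective.injOn
          intro x hx
          simpa [interval] using hx
      _ = l := by simp
  | periodic =>
    calc (interval L Boundary.periodic a l).card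
        ≤ (((Finset.range l).image fun j => (a + j) % L).card) := by
          refine Finset.card_le_card_of_injOn (fun x : Fin L => (x : ℕ)) ?_
            Fin.val_injective.injOn
          intro x hx
          simp only [interval, Finset.coe_filter, Finset.mem_univ, true_and,
            Set.mem_ofPred_eq] at hx
          obtain ⟨j, hj, hx⟩ := hx
          simp only [Finset.coe_image, Set.mem_image, Finset.coe_range, Set.mem_Iio]
          exact ⟨j, hj, hx.symm⟩
      _ ≤ (Finset.range l).card := Finset.card_image_le
      _ = l := Finset.card_range l

/-- Intervals of length `w` that meet a given interval lie in a common larger interval. -/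
theorem exists_interval_superset (L : ℕ) (bc : Boundary) (w a l : ℕ) :
    ∃ a', interval L bc a l ⊆ interval L bc a' (l + 2 * w) ∧ ∀ b, ¬ Disjoint (interval L bc b w) (interval L bc a l) →
      interval L bc b w ⊆ interval L bc a' (l + 2 * w) := by
  cases bc with
  | free =>
    refine ⟨a - w, fun x hx => ?_, fun b h x hx => ?_⟩
    · simp only [interval, Finset.mem_filter, Finset.mem_univ, true_and] at hx ⊢
      omega
    obtain ⟨y, hy, hy'⟩ := Finset.not_disjoint_iff.1 h
    simp only [interval, Finset.mem_filter, Finset.mem_univ, true_and] at hx hy hy' ⊢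
    omega
  | periodic =>
    -- Modulo `L` this is `a - w`, written without truncated subtraction.
    refine ⟨a + w * (L - 1), fun x hx => ?_, fun b h x hx => ?_⟩
    · simp only [interval, Finset.mem_filter, Finset.mem_univ, true_and] at hx ⊢
      obtain ⟨j, hj, hxj⟩ := hx
      obtain ⟨n, rfl⟩ : ∃ n, L = n + 1 := ⟨L - 1, by have := x.pos; omega⟩
      refine ⟨w + j, by omega, ?_⟩
      have h : a + w * (n + 1 - 1) + (w + j) = a + j + (n + 1) * w := by
        rw [Nat.add_sub_cancel]
        ring
      rw [hxj, h, Nat.add_mul_mod_self_left]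
    obtain ⟨y, hy, hy'⟩ := Finset.not_disjoint_iff.1 h
    simp only [interval, Finset.mem_filter, Finset.mem_univ, true_and] at hx hy hy' ⊢
    obtain ⟨j, hj, hxj⟩ := hx
    obtain ⟨k, hk, hyk⟩ := hy
    obtain ⟨m, hm, hym⟩ := hy'
    obtain ⟨n, rfl⟩ : ∃ n, L = n + 1 := ⟨L - 1, by have := x.pos; omega⟩
    refine ⟨w + m + j - k, by omega, ?_⟩
    have h1 : (b + k) ≡ (a + m) [MOD n + 1] := hyk.symm.trans hym
    rw [hxj]
    have h2 : a + w * (n + 1 - 1) + (w + m + j - k) + k = (a + m) + j + (n + 1) * w := by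
      have : w + m + j - k + k = w + m + j := Nat.sub_add_cancel (by omega)
      rw [add_assoc, this, Nat.add_sub_cancel]
      ring
    have h3 : (b + j) + k ≡ a + w * (n + 1 - 1) + (w + m + j - k) + k [MOD n + 1] := by
      rw [h2]
      calc (b + j) + k = (b + k) + j := by ring
        _ ≡ (a + m) + j [MOD n + 1] := h1.add_right j
        _ ≡ (a + m) + j + (n + 1) * w [MOD n + 1] := by
          simp [Nat.ModEq]
    exact Nat.ModEq.add_right_cancel' k h3

/-- An interval of length `w` that meets the inside of an interval away from its ends is contained
in that interval. -/
theorem interval_subset_of_mem (L : ℕ) (bc : Boundary) (w a l b : ℕ) {x : Fin L}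
    (hx : x ∈ interval L bc a l) (hx1 : x ∉ interval L bc a w)
    (hx2 : x ∉ interval L bc (a + (l - w)) w) (hxb : x ∈ interval L bc b w) :
    interval L bc b w ⊆ interval L bc a l := by
  intro y hy
  cases bc with
  | free =>
    simp only [interval, Finset.mem_filter, Finset.mem_univ, true_and] at *
    omega
  | periodic =>
    simp only [interval, Finset.mem_filter, Finset.mem_univ, true_and] at *
    obtain ⟨j, hj, hxj⟩ := hx
    obtain ⟨p, hp, hxp⟩ := hxb
    obtain ⟨q, hq, hyq⟩ := hy
    -- The offset `j` of `x` is at least `w` from both ends, while `y` differs from `x` by less than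
    -- `w`.
    have hjw : w ≤ j := by
      by_contra h
      exact hx1 ⟨j, by omega, hxj⟩
    have hjl : j < l - w := by
      by_contra h
      refine hx2 ⟨j - (l - w), by omega, ?_⟩
      rw [hxj]
      congr 1
      omega
    refine ⟨j + q - p, by omega, ?_⟩
    rw [hyq]
    have h1 : a + j ≡ b + p [MOD L] := hxj.symm.trans hxp
    refine Nat.ModEq.add_right_cancel' p ?_
    calc b + q + p = (b + p) + q := by ring
      _ ≡ (a + j) + q [MOD L] := (h1.add_right q).symm
      _ = a + (j + q - p) + p := by omega

/-- The columns are grouped into an even number of blocks of at least `W` consecutive columns (or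
into a single block, if there are fewer than `2 W` columns). -/
def columnBlock (L W : ℕ) (x : Fin L) : ℕ := min (x / W) (2 * (L / (2 * W)) - 1)

/-- The last block also receives the remainder of `L` modulo `2 * W`, hence up to `3 * W` columns.
-/
theorem mem_interval_of_columnBlock_eq (L W : ℕ) (bc : Boundary) (hW : 0 < W) {x : Fin L} {p : ℕ}
    (hx : columnBlock L W x = p) : x ∈ interval L bc (p * W) (3 * W) := by
  have h1 : p * W ≤ x := by
    refine (Nat.mul_le_mul_right W (?_ : p ≤ x / W)).trans (Nat.div_mul_le_self _ _)
    rw [← hx]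
    exact min_le_left _ _
  have h2 : (x : ℕ) < p * W + 3 * W := by
    unfold columnBlock at hx
    rcases le_total ((x : ℕ) / W) (2 * (L / (2 * W)) - 1) with h | h
    · rw [min_eq_left h] at hx
      have := Nat.lt_div_mul_add (a := x) hW
      rw [hx] at this
      omega
    · rw [min_eq_right h] at hx
      have h3 := Nat.lt_div_mul_add (a := L) (b := 2 * W) (by omega)
      have h4 : L / (2 * W) * (2 * W) ≤ p * W + W := by
        rw [← Nat.succ_mul, ← hx, ← mul_assoc]
        exact Nat.mul_le_mul_right W (by omega)
      have := x.2
      omega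
  cases bc with
  | free =>
    simp only [interval, Finset.mem_filter, Finset.mem_univ, true_and]
    exact ⟨h1, h2⟩
  | periodic =>
    simp only [interval, Finset.mem_filter, Finset.mem_univ, true_and]
    refine ⟨x - p * W, by omega, ?_⟩
    rw [Nat.add_sub_cancel' h1, Nat.mod_eq_of_lt x.2]

/-- Nearby columns lie in equal or adjacent blocks, and adjacent blocks have opposite parity. Around
the periodic boundary, the first and last blocks have opposite parity because the number of blocks
is even, unless there is only one. -/
theorem columnBlock_eq_of_lt (L W : ℕ) (hW : 0 < W) {x y : Fin L} (hxy : x ≤ y)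
    (h : (y : ℕ) < x + W ∨ (x : ℕ) + L < y + W)
    (hpar : columnBlock L W x % 2 = columnBlock L W y % 2) :
    columnBlock L W x = columnBlock L W y := by
  have hxy' : (x : ℕ) ≤ y := hxy
  unfold columnBlock at *
  rcases Nat.eq_zero_or_pos (L / (2 * W)) with h0 | h0
  · simp [h0]
  rcases h with h | h
  · have h1 : (y : ℕ) / W ≤ x / W + 1 := by
      rw [← Nat.add_div_right _ hW]
      exact Nat.div_le_div_right (by omega)
    have h2 : (x : ℕ) / W ≤ y / W := Nat.div_le_div_right hxy'
    omega
  · exfalso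
    have hy := y.2
    have h1 : (x : ℕ) / W = 0 := Nat.div_eq_of_lt (by omega)
    have h2 : 2 * (L / (2 * W)) - 1 ≤ (y : ℕ) / W := by
      rw [Nat.le_div_iff_mul_le hW, Nat.sub_mul]
      have := Nat.div_mul_le_self L (2 * W)
      have h3 : 2 * (L / (2 * W)) * W = L / (2 * W) * (2 * W) := by ring
      omega
    rw [h1, min_eq_right h2] at hpar
    omega

theorem columnBlock_eq_of_mem_interval (L W w : ℕ) (bc : Boundary) (hW : w < W) (b : ℕ)
    {x y : Fin L} (hx : x ∈ interval L bc b w) (hy : y ∈ interval L bc b w)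
    (hpar : columnBlock L W x % 2 = columnBlock L W y % 2) :
    columnBlock L W x = columnBlock L W y := by
  wlog hxy : x ≤ y generalizing x y
  · exact (this hy hx hpar.symm (le_of_not_ge hxy)).symm
  refine columnBlock_eq_of_lt L W (by omega) hxy ?_ hpar
  have hxy' : (x : ℕ) ≤ y := hxy
  cases bc with
  | free =>
    simp only [interval, Finset.mem_filter, Finset.mem_univ, true_and] at hx hy
    omega
  | periodic =>
    simp only [interval, Finset.mem_filter, Finset.mem_univ, true_and] at hx hy
    obtain ⟨j, hj, hxj⟩ := hx
    obtain ⟨k, hk, hyk⟩ := hy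
    by_contra hcon
    push Not at hcon
    have hyL := y.2
    -- If `x` and `y` were not close, then `W ≤ y - x ≤ L - W`. As `|k - j| < w < W`, this multiple
    -- of `L` would lie strictly between `0` and `L`.
    have h1 : (L : ℤ) ∣ (y - x : ℤ) - (k - j) := by
      refine ⟨((b + j) / L : ℕ) - ((b + k) / L : ℕ), ?_⟩
      have h2 : ((L * ((b + j) / L) + (b + j) % L : ℕ) : ℤ) = (b + j : ℕ) := by
        rw [Nat.div_add_mod]
      have h3 : ((L * ((b + k) / L) + (b + k) % L : ℕ) : ℤ) = (b + k : ℕ) := by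
        rw [Nat.div_add_mod]
      rw [← hxj, Nat.cast_add, Nat.cast_mul, Nat.cast_add] at h2
      rw [← hyk, Nat.cast_add, Nat.cast_mul, Nat.cast_add] at h3
      linear_combination h3 - h2
    have h4 := Int.le_of_dvd (by omega) h1
    omega

end Geometry

/-! ### A Hermitian witness and the tensor rank of the dressing. -/

namespace CommutingProjections

variable {Λ : Type} [Fintype Λ] [DecidableEq Λ] {F : CommutingProjections Λ}

/-- A matrix unit E is a linear combination of the Hermitian operators E + E† and i(E - E†), so
these cannot both compress to scalars. -/
theorem exists_hermitian_of_not_correctable {M : Finset Λ} (hM : ¬ F.Correctable M) :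
    ∃ G : QubitOp Λ, G.IsHermitian ∧ SupportedOn M G ∧
      (¬ ∃ c : ℂ, F.codeProj * G * F.codeProj = c • F.codeProj) ∧
      ∀ A B : Finset Λ, Disjoint A B → M ⊆ A ∪ B → TensorRankLE A B G 2 := by
  simp only [Correctable, not_forall] at hM
  obtain ⟨s, t, hst⟩ := hM
  let E := matrixUnit M s t
  let E' := matrixUnit M t s
  have hE : E.conjTranspose = E' := matrixUnit_conjTranspose M s t
  have hE' : E'.conjTranspose = E := matrixUnit_conjTranspose M t s
  have hS : SupportedOn M E := matrixUnit_supportedOn M s t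
  have hS' : SupportedOn M E' := matrixUnit_supportedOn M t s
  have hrank : ∀ (a b : ℂ) (A B : Finset Λ), Disjoint A B → M ⊆ A ∪ B →
      TensorRankLE A B (a • E + b • E') 2 := fun a b A B hAB hMAB =>
    ((matrixUnit_tensorRankLE hAB hMAB s t).smul a).add
      ((matrixUnit_tensorRankLE hAB hMAB t s).smul b)
  by_cases h1 : ∃ c : ℂ, F.codeProj * ((1 : ℂ) • E + (1 : ℂ) • E') * F.codeProj = c • F.codeProj
  · refine ⟨Complex.I • E + (-Complex.I) • E', ?_, (hS.smul _).add (hS'.smul _), ?_, hrank _ _⟩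
    · rw [Matrix.IsHermitian, Matrix.conjTranspose_add, Matrix.conjTranspose_smul,
        Matrix.conjTranspose_smul, hE, hE', star_neg, Complex.star_def, Complex.conj_I, neg_neg,
        add_comm]
    · rintro ⟨d, hd⟩
      obtain ⟨c, hc⟩ := h1
      refine hst ⟨(1 / 2) * (c - Complex.I * d), ?_⟩
      have h2 : E = (1 / 2 : ℂ) • (((1 : ℂ) • E + (1 : ℂ) • E') -
          Complex.I • (Complex.I • E + (-Complex.I) • E')) := by
        rw [smul_add, smul_smul, smul_smul, mul_neg, Complex.I_mul_I]
        module
      change F.codeProj * E * F.codeProj = _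
      rw [h2, mul_smul_comm, smul_mul_assoc, mul_sub, sub_mul, hc, mul_smul_comm, smul_mul_assoc,
        hd]
      module
  · refine ⟨(1 : ℂ) • E + (1 : ℂ) • E', ?_, (hS.smul _).add (hS'.smul _), h1, hrank _ _⟩
    rw [one_smul, one_smul, Matrix.IsHermitian, Matrix.conjTranspose_add, hE, hE', add_comm]

theorem dress_isHermitian {M : Finset Λ} {G : QubitOp Λ} (hG : G.IsHermitian) :
    (F.dress M G).IsHermitian := by
  rw [Matrix.IsHermitian, dress, Matrix.conjTranspose_mul, Matrix.conjTranspose_mul, hG.eq,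
    prodOf_conjTranspose, mul_assoc]

/-- Projections inside `A` or inside `B` multiply to operators of tensor rank one; only those
confined to `D` cost anything. -/
theorem prodOf_tensorRankLE (p : QubitOp Λ → Prop) [DecidablePred p] {A B D : Finset Λ}
    (hAB : Disjoint A B) (hD : D ⊆ A ∪ B)
    (h : ∀ P ∈ F.carrier, p P → F.region P ⊆ A ∨ F.region P ⊆ B ∨ F.region P ⊆ D) :
    TensorRankLE A B (F.prodOf p) (4 ^ D.card) := by
  have h1 : F.prodOf p = F.prodOf (fun P => p P ∧ F.region P ⊆ A) *
      (F.prodOf (fun P => p P ∧ F.region P ⊆ D) * F.prodOf (fun P => p P ∧ F.region P ⊆ B)) := by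
    rw [← prodOf_eq_mul (fun P => p P ∧ (F.region P ⊆ D ∨ F.region P ⊆ B))]
    · refine prodOf_eq_mul _ _ _ fun P hP => ?_
      have := h P hP
      tauto
    · intro P _
      tauto
  have hA : TensorRankLE A B (F.prodOf fun P => p P ∧ F.region P ⊆ A) 1 := by
    rw [← mul_one (F.prodOf _)]
    exact TensorRankLE.of_mul
      (prodOf_supportedOn fun P hP hp => (F.supportedOn P hP).mono hp.2) (SupportedOn.one B)
  have hB : TensorRankLE A B (F.prodOf fun P => p P ∧ F.region P ⊆ B) 1 := by
    rw [← one_mul (F.prodOf _)]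
    exact TensorRankLE.of_mul (SupportedOn.one A)
      (prodOf_supportedOn fun P hP hp => (F.supportedOn P hP).mono hp.2)
  have hC : TensorRankLE A B (F.prodOf fun P => p P ∧ F.region P ⊆ D) (4 ^ D.card) :=
    (prodOf_supportedOn fun P hP hp => (F.supportedOn P hP).mono hp.2).tensorRankLE hAB hD
  rw [h1]
  simpa using hA.mul hAB (hC.mul hAB hB)

end CommutingProjections

/-! ### Application to local codes on the lattice. -/

namespace LocalCommutingProjectorCode

variable {L : ℕ} {bc : Boundary} {w : ℕ} (C : LocalCommutingProjectorCode L bc w)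

theorem exists_square (P : QubitOp (Site L)) :
    ∃ ab : ℕ × ℕ, P ∈ C.projectors → SupportedOn (square L bc w ab.1 ab.2) P := by
  by_cases h : P ∈ C.projectors
  · obtain ⟨a, b, hab⟩ := C.isLocal P h
    exact ⟨(a, b), fun _ => hab⟩
  · exact ⟨(0, 0), fun h' => absurd h' h⟩

/-- The corner of a square on which a projector is supported. -/
noncomputable def corner (P : QubitOp (Site L)) : ℕ × ℕ := (C.exists_square P).choose

/-- The projectors of the code, each with a square on which it is supported. -/
noncomputable def toCommutingProjections : CommutingProjections (Site L) where
  carrier := C.projectors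
  isProj := C.isProj
  commute := C.commute
  region P := square L bc w (C.corner P).1 (C.corner P).2
  supportedOn P hP := (C.exists_square P).choose_spec hP

variable {C}

theorem codeProj_mulVec_of_mem {ψ : Config (Site L) → ℂ} (hψ : ψ ∈ C.codeSpace) :
    C.toCommutingProjections.codeProj.mulVec ψ = ψ :=
  CommutingProjections.codeProj_mulVec hψ

theorem codeProj_mulVec_mem (ψ : Config (Site L) → ℂ) :
    C.toCommutingProjections.codeProj.mulVec ψ ∈ C.codeSpace := by
  intro P hP
  rw [Matrix.mulVec_mulVec, CommutingProjections.mul_codeProj hP]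

theorem IsNontrivial.exists_orthogonal (h : C.IsNontrivial) :
    ∃ ψ ∈ C.codeSpace, ∃ φ ∈ C.codeSpace, ψ ≠ 0 ∧ φ ≠ 0 ∧ star ψ ⬝ᵥ φ = 0 := by
  have h' : 1 < Module.finrank ℂ C.codeSpace := h
  have hnt : Nontrivial C.codeSpace := Module.nontrivial_of_finrank_pos (zero_lt_one.trans h')
  obtain ⟨ψ, hψ⟩ := exists_ne (0 : C.codeSpace)
  let f : C.codeSpace →ₗ[ℂ] ℂ :=
    { toFun := fun φ => star (ψ : Config (Site L) → ℂ) ⬝ᵥ φ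
      map_add' := fun x y => dotProduct_add _ _ _
      map_smul' := fun c x => dotProduct_smul c _ _ }
  have hf : LinearMap.ker f ≠ ⊥ := by
    refine LinearMap.ker_ne_bot_of_finrank_lt ?_
    rwa [Module.finrank_self]
  obtain ⟨φ, hφ, hφ0⟩ := (Submodule.ne_bot_iff _).1 hf
  exact ⟨ψ, ψ.2, φ, φ.2, fun h => hψ (Subtype.ext h), fun h => hφ0 (Subtype.ext h), hφ⟩

/-- Dressing does not change the compression to the code space, so a scalar action would contradict
`hG'`. -/
theorem isNontrivialLogical_dress {M : Finset (Site L)} {G : QubitOp (Site L)}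
    (hG : SupportedOn M G)
    (hG' : ¬ ∃ c : ℂ, C.toCommutingProjections.codeProj * G * C.toCommutingProjections.codeProj =
      c • C.toCommutingProjections.codeProj) :
    C.IsNontrivialLogical (C.toCommutingProjections.dress M G) := by
  refine ⟨fun ψ hψ P hP => ?_, ?_⟩
  · rw [Matrix.mulVec_mulVec, ← (CommutingProjections.dress_commute hG hP).eq,
      ← Matrix.mulVec_mulVec, hψ P hP]
  · rintro ⟨c, hc⟩
    refine hG' ⟨c, ?_⟩
    have h : C.toCommutingProjections.dress M G * C.toCommutingProjections.codeProj =
        c • C.toCommutingProjections.codeProj := by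
      refine Matrix.ext_of_mulVec_single fun s => ?_
      rw [← Matrix.mulVec_mulVec, hc _ (codeProj_mulVec_mem _), Matrix.smul_mulVec]
    rw [← CommutingProjections.codeProj_dress_codeProj, mul_assoc, h, mul_smul_comm,
      CommutingProjections.codeProj_mul_self]

theorem exists_block_not_correctable (h : C.IsNontrivial) :
    ∃ p, ¬ C.toCommutingProjections.Correctable
      (Finset.univ.filter fun x : Site L => columnBlock L (w + 1) x.1 = p) := by
  obtain ⟨ψ, hψ, φ, hφ, hψ0, hφ0, horth⟩ := h.exists_orthogonal
  refine CommutingProjections.exists_block_not_correctable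
    (fun x : Site L => columnBlock L (w + 1) x.1) (fun P _ x hx y hy => ?_)
    (codeProj_mulVec_of_mem hψ) (codeProj_mulVec_of_mem hφ) hψ0 hφ0 horth
  exact columnBlock_eq_of_mem_interval L (w + 1) w bc (Nat.lt_succ_self w) _
    (Finset.mem_product.1 hx).1 (Finset.mem_product.1 hy).1

/-- A product of local projectors that lie in a strip has bounded tensor rank across every cut. -/
theorem prodOf_tensorRankLE_of_isStripDivision (p : QubitOp (Site L) → Prop) [DecidablePred p]
    {r i : ℕ} (hp : ∀ P ∈ C.projectors, p P →
      C.toCommutingProjections.region P ⊆ strip L bc r i)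
    {A B : Finset (Site L)} (hAB : IsStripDivision L bc r i A B) :
    TensorRankLE A B (C.toCommutingProjections.prodOf p) (4 ^ (r * (4 * w))) := by
  obtain ⟨a, h, a', h', hc, rfl, rfl⟩ := hAB
  have hdisj : Disjoint (interval L bc i r ×ˢ interval L bc a h)
      (interval L bc i r ×ˢ interval L bc a' h') := by
    rw [Finset.disjoint_product, hc]
    exact Or.inr disjoint_compl_right
  have hcov : ∀ x, x ∈ interval L bc a h ∨ x ∈ interval L bc a' h' := fun x => by
    rw [hc, Finset.mem_compl]
    exact em _
  -- The first and last `w` rows of both intervals. A square whose rows fit in neither interval has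
  -- all its rows here, by `interval_subset_of_mem`.
  let N : Finset (Fin L) := (interval L bc a w ∪ interval L bc (a + (h - w)) w) ∪
    (interval L bc a' w ∪ interval L bc (a' + (h' - w)) w)
  have hN : N.card ≤ 4 * w := by
    have h1 := Finset.card_union_le (interval L bc a w ∪ interval L bc (a + (h - w)) w)
      (interval L bc a' w ∪ interval L bc (a' + (h' - w)) w)
    have h2 := Finset.card_union_le (interval L bc a w) (interval L bc (a + (h - w)) w)
    have h3 := Finset.card_union_le (interval L bc a' w) (interval L bc (a' + (h' - w)) w)
    have h4 := card_interval_le L bc a w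
    have h5 := card_interval_le L bc (a + (h - w)) w
    have h6 := card_interval_le L bc a' w
    have h7 := card_interval_le L bc (a' + (h' - w)) w
    have h8 : N.card ≤ _ := h1
    omega
  have hcard : (interval L bc i r ×ˢ N).card ≤ r * (4 * w) := by
    rw [Finset.card_product]
    exact Nat.mul_le_mul (card_interval_le L bc i r) hN
  refine (CommutingProjections.prodOf_tensorRankLE p (D := interval L bc i r ×ˢ N) hdisj
    (fun x hx => ?_) fun P hP hpP => ?_).mono (Nat.pow_le_pow_right (by norm_num) hcard)
  · simp only [Finset.mem_union, Finset.mem_product] at hx ⊢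
    have := hcov x.2
    tauto
  · have hsub := hp P hP hpP
    have hcol : ∀ x ∈ C.toCommutingProjections.region P, x.1 ∈ interval L bc i r := fun x hx =>
      (Finset.mem_product.1 (hsub hx)).1
    have hrow : ∀ x ∈ C.toCommutingProjections.region P,
        x.2 ∈ interval L bc (C.corner P).2 w := fun x hx => (Finset.mem_product.1 hx).2
    by_cases h1 : interval L bc (C.corner P).2 w ⊆ interval L bc a h
    · exact Or.inl fun x hx => Finset.mem_product.2 ⟨hcol x hx, h1 (hrow x hx)⟩
    by_cases h2 : interval L bc (C.corner P).2 w ⊆ interval L bc a' h'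
    · exact Or.inr (Or.inl fun x hx => Finset.mem_product.2 ⟨hcol x hx, h2 (hrow x hx)⟩)
    refine Or.inr (Or.inr fun x hx => Finset.mem_product.2 ⟨hcol x hx, ?_⟩)
    have hx2 := hrow x hx
    by_contra hxN
    simp only [N, Finset.mem_union, not_or] at hxN
    rcases hcov x.2 with hx' | hx'
    · exact h1 (interval_subset_of_mem L bc w a h _ hx' hxN.1.1 hxN.1.2 hx2)
    · exact h2 (interval_subset_of_mem L bc w a' h' _ hx' hxN.2.1 hxN.2.2 hx2)

end LocalCommutingProjectorCode

theorem IsStripDivision.disjoint {L : ℕ} {bc : Boundary} {r i : ℕ} {A B : Finset (Site L)}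
    (h : IsStripDivision L bc r i A B) : Disjoint A B := by
  obtain ⟨a, h, a', h', hc, rfl, rfl⟩ := h
  rw [Finset.disjoint_product, hc]
  exact Or.inr disjoint_compl_right

theorem IsStripDivision.strip_subset {L : ℕ} {bc : Boundary} {r i : ℕ} {A B : Finset (Site L)}
    (h : IsStripDivision L bc r i A B) : strip L bc r i ⊆ A ∪ B := by
  obtain ⟨a, h, a', h', hc, rfl, rfl⟩ := h
  rw [← Finset.product_union, hc, Finset.union_compl]
  exact Finset.Subset.rfl

theorem lemma13 (w : ℕ) :
    ∃ r K : ℕ, ∀ (L : ℕ) (bc : Boundary) (C : LocalCommutingProjectorCode L bc w),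
      C.IsNontrivial →
        ∃ (i : ℕ) (H : QubitOp (Site L)),
          H.IsHermitian ∧ C.IsNontrivialLogical H ∧ SupportedOn (strip L bc r i) H ∧
            ∀ A B : Finset (Site L), IsStripDivision L bc r i A B →
              ∃ m : ℕ, m ≤ K ∧ HasSchmidtRank A B H m := by
  -- A block of columns spans at most `3 * (w + 1)`, and the projectors touching it reach at most
  -- `w` further on either side.
  let r := 3 * (w + 1) + 2 * w
  let k := 4 ^ (r * (4 * w))
  -- One factor `k` for each copy of the dressing product, and `2` for the Hermitian witness between
  -- them.
  refine ⟨r, k * 2 * k, fun L bc C hC => ?_⟩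
  obtain ⟨p, hp⟩ := LocalCommutingProjectorCode.exists_block_not_correctable hC
  set M : Finset (Site L) := Finset.univ.filter fun x => columnBlock L (w + 1) x.1 = p
  obtain ⟨G, hGherm, hGM, hG, hGrank⟩ :=
    CommutingProjections.exists_hermitian_of_not_correctable hp
  obtain ⟨i, hi0, hi⟩ := exists_interval_superset L bc w (p * (w + 1)) (3 * (w + 1))
  have hcol : ∀ x ∈ M, x.1 ∈ interval L bc (p * (w + 1)) (3 * (w + 1)) := fun x hx =>
    mem_interval_of_columnBlock_eq L (w + 1) bc w.succ_pos (Finset.mem_filter.1 hx).2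
  have hreg : ∀ P ∈ C.projectors, C.toCommutingProjections.Touches M P →
      C.toCommutingProjections.region P ⊆ strip L bc r i := by
    intro P _ hP
    obtain ⟨x, hx, hxM⟩ := Finset.not_disjoint_iff.1 hP
    have h1 := hi (C.corner P).1
      (Finset.not_disjoint_iff.2 ⟨x.1, (Finset.mem_product.1 hx).1, hcol x hxM⟩)
    exact Finset.product_subset_product h1 (Finset.subset_univ _)
  have hMstrip : M ⊆ strip L bc r i := fun x hx =>
    Finset.mem_product.2 ⟨hi0 (hcol x hx), Finset.mem_univ _⟩
  have hprod : SupportedOn (strip L bc r i)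
      (C.toCommutingProjections.prodOf (C.toCommutingProjections.Touches M)) :=
    CommutingProjections.prodOf_supportedOn fun P hP hPM =>
      (C.toCommutingProjections.supportedOn P hP).mono (hreg P hP hPM)
  refine ⟨i, C.toCommutingProjections.dress M G, CommutingProjections.dress_isHermitian hGherm,
    LocalCommutingProjectorCode.isNontrivialLogical_dress hGM hG,
    (hprod.mul (hGM.mono hMstrip)).mul hprod, fun A B hAB => ?_⟩
  have hrank := LocalCommutingProjectorCode.prodOf_tensorRankLE_of_isStripDivision _ hreg hAB
  exact ((hrank.mul hAB.disjoint (hGrank A B hAB.disjoint (hMstrip.trans hAB.strip_subset))).mul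
    hAB.disjoint hrank).hasSchmidtRank hAB.disjoint
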